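/- Let $T$ be a complete first-order theory in a language $L$ and let $\mathfrak C$ be its monster model: for some uncountable strong limit cardinal $\bar\kappa>|L|$, $\mathfrak C\models T$ is $\bar\kappa$-saturated and strongly $\bar\kappa$-homogeneous; "small" means of cardinality $<\bar\kappa$. A hyperimaginary is an equivalence class $e=a_E$ of a small tuple $a$ of elements of $\mathfrak C$ under an equivalence relation $E$ that is type-definable over $\emptyset$. Let $\mathrm{Fix}(e)$ be the group of automorphisms of $\mathfrak C$ fixing $e$. For a set or class $A$ of hyperimaginaries, $\mathrm{dcl}(A)$ is the class of all hyperimaginaries fixed by every automorphism that fixes each member of $A$; $e$ is interdefinable with a sequence $(e_i:i\in I)$, written $e\sim(e_i:i\in I)$, if $\mathrm{dcl}(e)=\mathrm{dcl}(e_i:i\in I)$; and a hyperimaginary $c$ is (a representative of) $\inf(e,d)$ if $\mathrm{dcl}(c)=\mathrm{dcl}(e)\cap\mathrm{dcl}(d)$. A hyperimaginary is normal if $\mathrm{Fix}(e)$ is a normal subgroup of $\mathrm{Aut}(\mathfrak C)$, bounded if its orbit under $\mathrm{Aut}(\mathfrak C)$ is small, and finitary if it is fixed by all automorphisms that fix pointwise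 some finite set of elements of $\mathfrak C$. Let $\mathrm{bdd}(\emptyset)$ be the class of all bounded hyperimaginaries. Call a small family $(e_i:i\in I)$ of finitary normal hyperimaginaries a Peter-Weyl family if $\mathrm{dcl}(e_i:i\in I)=\mathrm{bdd}(\emptyset)$, and call a family closed under finite composition if for all $i,j\in I$ there is $k\in I$ with $e_k\sim(e_i,e_j)$. Corollary (Lascar-Pillay, assuming Peter-Weyl's condition). Assume Peter-Weyl's condition: there is a Peter-Weyl family. Then: 1. Every bounded hyperimaginary is interdefinable with a small sequence of finitary hyperimaginaries. 2. For every Peter-Weyl family $(e_i:i\in I)$ there are hyperimaginaries $e'_s\sim(e_i:i\in s)$, for $s$ ranging over the finite subsets of $I$, and $(e'_s)_s$ is a Peter-Weyl family closed under finite composition. 3. If $(e_i:i\in I)$ is a Peter-Weyl family closed under finite composition, then for every bounded hyperimaginary $d$ each $\inf(e_i,d)$ is (represented by) a finitary hyperimaginary, and $d\sim(\inf(e_i,d):i\in I)$. -/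

import Mathlib

open FirstOrder

universe u v w

namespace NormalHyperimaginaries

/-! ### The monster model -/

/-- `M` is `κ`-saturated: every set of formulas in one variable with fewer than `κ` parameters
(the tuple `a`) that is finitely satisfiable in `M` is realized in `M`. -/
def IsSaturated (L : FirstOrder.Language.{u, v}) (M : Type w) [L.Structure M] (κ : Cardinal.{w}) : Prop :=
  ∀ (ι : Type w) (a : ι → M) (p : Set (L.Formula (ι ⊕ Unit))), Cardinal.mk ι < κ →
    (∀ q : Finset (L.Formula (ι ⊕ Unit)), (q : Set (L.Formula (ι ⊕ Unit))) ⊆ p →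
      ∃ x : M, ∀ φ ∈ q, φ.Realize (Sum.elim a (fun _ => x))) →
    ∃ x : M, ∀ φ ∈ p, φ.Realize (Sum.elim a (fun _ => x))

/-- The tuples `a` and `b` have the same (complete) type over the empty set. -/
def SameType (L : FirstOrder.Language.{u, v}) {M : Type w} [L.Structure M] {ι : Type w} (a b : ι → M) : Prop :=
  ∀ φ : L.Formula ι, φ.Realize a ↔ φ.Realize b

/-- `M` is strongly `κ`-homogeneous: two tuples of length less than `κ` with the same type are
conjugate under an automorphism. -/
def IsStronglyHomogeneous (L : FirstOrder.Language.{u, v}) (M : Type w) [L.Structure M]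
    (κ : Cardinal.{w}) : Prop :=
  ∀ (ι : Type w) (a b : ι → M), Cardinal.mk ι < κ → SameType L a b →
    ∃ f : M ≃[L] M, ∀ i, f (a i) = b i

/-- `M` is a monster model (of its complete theory): for an uncountable strong limit cardinal `κ`
greater than the cardinality of the language, it is `κ`-saturated and strongly `κ`-homogeneous.
"Small" means of cardinality less than `κ`. -/
structure IsMonster (L : FirstOrder.Language.{u, v}) (M : Type w) [L.Structure M] (κ : Cardinal.{w}) :
    Prop where
  uncountable : Cardinal.aleph0 < κ
  strongLimit : κ.IsStrongLimit
  card_lt : Cardinal.lift.{w} L.card < Cardinal.lift.{max u v} κ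
  saturated : IsSaturated L M κ
  homogeneous : IsStronglyHomogeneous L M κ

/-! ### The automorphism group -/

section Aut

variable {L : FirstOrder.Language.{u, v}} {M : Type w} [L.Structure M]

/-- The group of automorphisms of `M`, with composition. -/
instance autGroup : Group (M ≃[L] M) where
  mul f g := f.comp g
  one := FirstOrder.Language.Equiv.refl L M
  inv f := f.symm
  mul_assoc _ _ _ := FirstOrder.Language.Equiv.ext fun _ => rfl
  one_mul _ := FirstOrder.Language.Equiv.ext fun _ => rfl
  mul_one _ := FirstOrder.Language.Equiv.ext fun _ => rfl
  inv_mul_cancel f := FirstOrder.Language.Equiv.ext fun x => f.symm_apply_apply x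

/-! ### Hyperimaginaries -/

/-- `E` is type-definable over the empty set: it is defined by a set of formulas without
parameters. -/
def IsTypeDefinable (L : FirstOrder.Language.{u, v}) {M : Type w} [L.Structure M] {ι : Type w}
    (E : (ι → M) → (ι → M) → Prop) : Prop :=
  ∃ Γ : Set (L.Formula (ι ⊕ ι)), ∀ x y, E x y ↔ ∀ φ ∈ Γ, φ.Realize (Sum.elim x y)

theorem IsTypeDefinable.map_aut {ι : Type w} {E : (ι → M) → (ι → M) → Prop}
    (hE : IsTypeDefinable L E) (f : M ≃[L] M) {x y : ι → M} (h : E x y) : E (f ∘ x) (f ∘ y) := by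
  obtain ⟨Γ, hΓ⟩ := hE
  rw [hΓ] at h ⊢
  intro φ hφ
  have h1 := (FirstOrder.Language.StrongHomClass.realize_formula f φ (v := Sum.elim x y)).2 (h φ hφ)
  rwa [Sum.comp_elim] at h1

end Aut

/-- A hyperimaginary: a class (`cls`) of an equivalence relation on tuples of a fixed small length
which is type-definable over the empty set. -/
structure Hyperimaginary (L : FirstOrder.Language.{u, v}) (M : Type w) [L.Structure M]
    (κ : Cardinal.{w}) where
  ι : Type w
  small : Cardinal.mk ι < κ
  rel : Setoid (ι → M)
  typeDefinable : IsTypeDefinable L (fun x y => rel x y)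
  cls : Quotient rel

namespace Hyperimaginary

variable {L : FirstOrder.Language.{u, v}} {M : Type w} [L.Structure M] {κ : Cardinal.{w}}

/-- The action of automorphisms on the classes of the equivalence relation of `e`:
`f` sends the class of `a` to the class of `f ∘ a`. -/
instance actionOnClasses (e : Hyperimaginary L M κ) :
    MulAction (M ≃[L] M) (Quotient e.rel) where
  smul f c := Quotient.map (fun a : e.ι → M => (f ∘ a : e.ι → M))
    (fun _ _ h => e.typeDefinable.map_aut f h) c
  one_smul c := by
    induction c using Quotient.inductionOn
    rfl
  mul_smul f g c := by
    induction c using Quotient.inductionOn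
    rfl

/-- `Fix(e)`, the group of automorphisms fixing `e`. -/
def fix (e : Hyperimaginary L M κ) : Subgroup (M ≃[L] M) :=
  MulAction.stabilizer (M ≃[L] M) e.cls

/-- `e` is normal: `Fix(e)` is a normal subgroup of the automorphism group. -/
def IsNormal (e : Hyperimaginary L M κ) : Prop := e.fix.Normal

/-- `e` is bounded: its orbit is small. -/
def IsBounded (e : Hyperimaginary L M κ) : Prop :=
  Cardinal.mk (MulAction.orbit (M ≃[L] M) e.cls) < κ

/-- `e` is finitary: it is definable over a finite set of real elements. -/
def IsFinitary (e : Hyperimaginary L M κ) : Prop :=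
  ∃ A : Set M, A.Finite ∧ ∀ f : M ≃[L] M, (∀ x ∈ A, f x = x) → f ∈ e.fix

end Hyperimaginary

section Closure

variable {L : FirstOrder.Language.{u, v}} {M : Type w} [L.Structure M] {κ : Cardinal.{w}}

/-- `dcl(A)`, the class of the hyperimaginaries fixed by every automorphism that fixes all
the hyperimaginaries in `A`. -/
def dcl (A : Set (Hyperimaginary L M κ)) : Set (Hyperimaginary L M κ) :=
  {d | ∀ f : M ≃[L] M, (∀ e ∈ A, f ∈ e.fix) → f ∈ d.fix}

/-- `bdd(∅)`, the class of all bounded hyperimaginaries. -/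
def bdd (L : FirstOrder.Language.{u, v}) (M : Type w) [L.Structure M] (κ : Cardinal.{w}) :
    Set (Hyperimaginary L M κ) :=
  {d | d.IsBounded}

/-- The hyperimaginary `d` is interdefinable with the sequence `(e i : i ∈ I)`. -/
def InterdefinableWithSeq {I : Type w} (d : Hyperimaginary L M κ) (e : I → Hyperimaginary L M κ) :
    Prop :=
  dcl {d} = dcl (Set.range e)

/-- `c` represents `inf(e, d)` in the lattice of definably closed classes:
`dcl(c) = dcl(e) ∩ dcl(d)`. -/
def IsInf (c e d : Hyperimaginary L M κ) : Prop :=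
  dcl {c} = dcl {e} ∩ dcl {d}

/-- `(e i : i ∈ I)` is a (small) sequence of finitary normal hyperimaginaries that is
interdefinable with `bdd(∅)`. -/
structure IsPeterWeylFamily {I : Type w} (e : I → Hyperimaginary L M κ) : Prop where
  small : Cardinal.mk I < κ
  finitary : ∀ i, (e i).IsFinitary
  normal : ∀ i, (e i).IsNormal
  dcl_eq_bdd : dcl (Set.range e) = bdd L M κ

/-- The family is closed under finite composition: for all `i, j` some `e k` is interdefinable
with the pair `(e i, e j)`. -/
def ClosedUnderComposition {I : Type w} (e : I → Hyperimaginary L M κ) : Prop :=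
  ∀ i j, ∃ k, dcl {e k} = dcl {e i, e j}

/-- Peter-Weyl's condition. -/
def PeterWeylCondition (L : FirstOrder.Language.{u, v}) (M : Type w) [L.Structure M]
    (κ : Cardinal.{w}) :
    Prop :=
  ∃ (I : Type w) (e : I → Hyperimaginary L M κ), IsPeterWeylFamily e

end Closure

end NormalHyperimaginaries

open NormalHyperimaginaries

/-!
Everything is read off from stabilizers in the automorphism group: `d ∈ dcl(c)` iff
`Fix(c) ≤ Fix(d)`, and interdefinability with a sequence means that `Fix(d)` is the intersection of
the stabilizers of its members.

A subgroup `H` is a stabilizer of a hyperimaginary once, on the conjugates of some small tuple `m`,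
the relation `f⁻¹ * g ∈ H` between `f m` and `g m` is type-definable (`IsMonster.exists_fix_eq`).
In the monster model type-definable conditions are closed under quantification over small tuples
(`IsTypeDefinableCondition.exists_tuple`, a consequence of `IsSaturated.exists_tuple`). So the
criterion applies to `Fix(e) ⊔ Fix(d)` when `e` is normal (`IsMonster.exists_fix_eq_sup`), because
this supremum is then a product; the hyperimaginary obtained represents `inf(e, d)`, and it is
finitary if `e` is. It also applies to intersections of stabilizers of families of small total
length (`IsMonster.exists_fix_eq_iInf`), which gives the finite compositions.

If `(e i)` is a Peter-Weyl family closed under composition and `d` is bounded, it remains to see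
that the intersection of the groups `Fix(e i) ⊔ Fix(d)` is `Fix(d)`
(`IsMonster.mem_fix_of_forall_mem_sup`). This is a compactness argument on the directed family of
the `Fix(e i)`. Since `κ` may be singular, it is run with representatives of the `e i` that are
classes of finite tuples (`IsMonster.exists_finite_fix_eq`). The statement on arbitrary bounded
hyperimaginaries follows by passing to the finite compositions of a given Peter-Weyl family.
-/

namespace NormalHyperimaginaries

open FirstOrder.Language Filter

variable {L : FirstOrder.Language.{u, v}} {M : Type w} [L.Structure M] {κ : Cardinal.{w}}

/-! ### Saturation in infinitely many variables -/

/-- A formula mentions only finitely many of the variables in `β`. -/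
theorem exists_formula_sum_fin {α β : Type*} (φ : L.Formula (α ⊕ β)) :
    ∃ (n : ℕ) (t : Fin n → β) (ψ : L.Formula (α ⊕ Fin n)), Function.Injective t ∧
      ∀ (a : α → M) (b : β → M),
        φ.Realize (Sum.elim a b) ↔ ψ.Realize (Sum.elim a (b ∘ t)) := by
  classical
  let s : Finset β := φ.freeVarFinset.toRight
  let g : φ.freeVarFinset → α ⊕ Fin s.card := fun x =>
    match x with
    | ⟨Sum.inl i, _⟩ => Sum.inl i
    | ⟨Sum.inr j, h⟩ => Sum.inr (s.equivFin ⟨j, Finset.mem_toRight.2 h⟩)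
  refine ⟨s.card, fun k => (s.equivFin.symm k).1, φ.restrictFreeVar g,
    Subtype.val_injective.comp s.equivFin.symm.injective, fun a b => ?_⟩
  refine (BoundedFormula.realize_restrictFreeVar _ ?_).symm
  rintro ⟨i | j, h⟩ <;> simp [g]

/-- Projecting a finite set of formulas along any set of variables yields a first-order formula. -/
theorem exists_formula_iff_exists {α β : Type*} (q : Finset (L.Formula (α ⊕ β))) :
    ∃ ψ : L.Formula α, ∀ a : α → M,
      ψ.Realize a ↔ ∃ b : β → M, ∀ φ ∈ q, φ.Realize (Sum.elim a b) := by
  by_cases hβ : Nonempty (β → M)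
  · obtain ⟨b₀⟩ := hβ
    obtain ⟨n, t, ψ, ht, hψ⟩ :=
      exists_formula_sum_fin (M := M) (Formula.iInf fun φ : q => (φ : L.Formula (α ⊕ β)))
    have hq : ∀ (a : α → M) (b : β → M),
        ψ.Realize (Sum.elim a (b ∘ t)) ↔ ∀ φ ∈ q, φ.Realize (Sum.elim a b) := fun a b => by
      rw [← hψ]
      simp
    refine ⟨ψ.iExs (Fin n), fun a => ?_⟩
    rw [Formula.realize_iExs]
    constructor
    · rintro ⟨c, hc⟩
      refine ⟨Function.extend t c b₀, (hq _ _).1 ?_⟩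
      rwa [Function.extend_comp ht]
    · rintro ⟨b, hb⟩
      exact ⟨b ∘ t, (hq a b).2 hb⟩
  · exact ⟨⊥, fun a => ⟨fun h => h.elim, fun ⟨b, _⟩ => (hβ ⟨b⟩).elim⟩⟩

/-- For an ultrafilter `U` of tuples, a set `g` of pairs `(j, m)` is elementary over the
parameters `a` if assigning `m` to the variable `j`, for `(j, m) ∈ g`, satisfies every formula
which holds for `U`-almost all tuples. -/
def IsElementaryAssignment {α β : Type w} (L : FirstOrder.Language.{u, v}) [L.Structure M]
    (a : α → M) (U : Ultrafilter (β → M)) (g : Set (β × M)) : Prop :=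
  ∀ (n : ℕ) (t : Fin n → β × M), (∀ k, t k ∈ g) → ∀ φ : L.Formula (α ⊕ Fin n),
    (∀ᶠ x in (U : Filter (β → M)), φ.Realize (Sum.elim a fun k => x (t k).1)) →
      φ.Realize (Sum.elim a fun k => (t k).2)

namespace IsElementaryAssignment

variable {α β : Type w} {a : α → M} {U : Ultrafilter (β → M)} {g : Set (β × M)}

theorem realize (hg : IsElementaryAssignment L a U g) (φ : L.Formula (α ⊕ g))
    (h : ∀ᶠ x in (U : Filter (β → M)), φ.Realize (Sum.elim a fun t => x t.1.1)) :
    φ.Realize (Sum.elim a fun t => t.1.2) := by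
  obtain ⟨n, t, ψ, -, hψ⟩ := exists_formula_sum_fin (M := M) φ
  refine (hψ _ _).2 (hg n (fun k => t k) (fun k => (t k).2) ψ ?_)
  filter_upwards [h] with x hx
  exact (hψ _ _).1 hx

theorem empty : IsElementaryAssignment L a U (∅ : Set (β × M)) := by
  intro n t ht φ h
  obtain ⟨x, hx⟩ := h.exists
  convert hx using 2
  funext k
  exact (ht k).elim

theorem sUnion {c : Set (Set (β × M))} (hc : IsChain (· ⊆ ·) c) (hne : c.Nonempty)
    (h : ∀ g ∈ c, IsElementaryAssignment L a U g) : IsElementaryAssignment L a U (⋃₀ c) := by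
  intro n t ht
  obtain ⟨g, hg, hgt⟩ := hc.directedOn.exists_mem_subset_of_finite_of_subset_sUnion hne
    (Set.finite_range t) (Set.range_subset_iff.2 ht)
  exact h g hg n t fun k => hgt ⟨k, rfl⟩

theorem eq_of_mem (hg : IsElementaryAssignment L a U g) {j : β} {m m' : M} (h : (j, m) ∈ g)
    (h' : (j, m') ∈ g) : m = m' := by
  have := hg 2 ![(j, m), (j, m')] (fun k => by fin_cases k <;> assumption)
    (Term.equal (Term.var (Sum.inr 0)) (Term.var (Sum.inr 1)))
    (Eventually.of_forall fun x => by simp [Formula.realize_equal])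
  simpa [Formula.realize_equal] using this

theorem mk_le (hg : IsElementaryAssignment L a U g) : Cardinal.mk g ≤ Cardinal.mk β := by
  refine Cardinal.mk_le_of_injective (f := fun t : g => t.1.1) ?_
  rintro ⟨⟨j, m⟩, h⟩ ⟨⟨j', m'⟩, h'⟩ (rfl : j = j')
  rw [Subtype.mk.injEq, hg.eq_of_mem h h']

/-- In a saturated structure, an elementary assignment extends to any further variable. -/
theorem exists_insert (hκ : Cardinal.aleph0 ≤ κ) (hM : IsSaturated L M κ)
    (hα : Cardinal.mk α < κ) (hβ : Cardinal.mk β < κ)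
    (hg : IsElementaryAssignment L a U g) (j : β) :
    ∃ m : M, IsElementaryAssignment L a U (insert (j, m) g) := by
  classical
  obtain ⟨m, hm⟩ := hM (α ⊕ g) (Sum.elim a fun t => t.1.2)
    {φ | ∀ᶠ x in (U : Filter (β → M)), φ.Realize (Sum.elim (Sum.elim a fun t => x t.1.1) fun _ => x j)}
    (by
      rw [Cardinal.mk_sum, Cardinal.lift_id, Cardinal.lift_id]
      exact Cardinal.add_lt_of_lt hκ hα (hg.mk_le.trans_lt hβ))
    (by
      intro q hq
      obtain ⟨ψ, hψ⟩ := exists_formula_iff_exists (M := M) q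
      have h := hg.realize ψ (by
        filter_upwards [(eventually_all_finset q).2 hq] with x hx
        exact (hψ _).2 ⟨_, hx⟩)
      obtain ⟨b, hb⟩ := (hψ _).1 h
      exact ⟨b (), hb⟩)
  refine ⟨m, fun n t ht φ h => ?_⟩
  let r : α ⊕ Fin n → (α ⊕ g) ⊕ Unit := Sum.elim (fun i => Sum.inl (Sum.inl i))
    fun k => if hk : t k ∈ g then Sum.inl (Sum.inr ⟨t k, hk⟩) else Sum.inr ()
  have h1 : ∀ k, t k ∉ g → t k = (j, m) := fun k hk => (ht k).resolve_right hk
  have h2 := hm (φ.relabel r) (by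
    filter_upwards [h] with x hx
    rw [Formula.realize_relabel]
    convert hx using 1
    funext i
    rcases i with i | k
    · rfl
    · by_cases hk : t k ∈ g
      · simp [r, hk]
      · simp [r, h1 k hk, h1 k hk ▸ hk])
  rw [Formula.realize_relabel] at h2
  convert h2 using 1
  funext i
  rcases i with i | k
  · rfl
  · by_cases hk : t k ∈ g
    · simp [r, hk]
    · simp [r, h1 k hk, h1 k hk ▸ hk]

end IsElementaryAssignment

/-- A saturated structure realizes small types in a small number of variables. The type is
completed along an ultrafilter of tuples, and the completion is realized one variable at a time. -/
theorem IsSaturated.exists_tuple (hκ : Cardinal.aleph0 ≤ κ) (hM : IsSaturated L M κ)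
    {α β : Type w} (hα : Cardinal.mk α < κ) (hβ : Cardinal.mk β < κ) (a : α → M)
    (p : Set (L.Formula (α ⊕ β)))
    (hp : ∀ q : Finset (L.Formula (α ⊕ β)), (q : Set (L.Formula (α ⊕ β))) ⊆ p →
      ∃ b : β → M, ∀ φ ∈ q, φ.Realize (Sum.elim a b)) :
    ∃ b : β → M, ∀ φ ∈ p, φ.Realize (Sum.elim a b) := by
  classical
  let D : L.Formula (α ⊕ β) → Set (β → M) := fun φ => {b | φ.Realize (Sum.elim a b)}
  obtain ⟨U, hpU⟩ := Ultrafilter.exists_ultrafilter_of_finite_inter_nonempty (D '' p) (by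
    intro T hT
    obtain ⟨q, hq, rfl⟩ := Finset.subset_set_image_iff.1 hT
    obtain ⟨b, hb⟩ := hp q hq
    exact ⟨b, by simpa [D] using hb⟩)
  have hU : ∀ φ ∈ p, ∀ᶠ x in (U : Filter (β → M)), φ.Realize (Sum.elim a x) := fun φ hφ =>
    hpU (Set.mem_image_of_mem D hφ)
  obtain ⟨g, -, hg⟩ := zorn_subset_nonempty {g | IsElementaryAssignment L a U g}
    (fun c hc hch hcne => ⟨⋃₀ c, IsElementaryAssignment.sUnion hch hcne hc,
      fun s hs => Set.subset_sUnion_of_mem hs⟩) ∅ IsElementaryAssignment.empty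
  have hg' : IsElementaryAssignment L a U g := hg.prop
  have htot : ∀ j, ∃ m, (j, m) ∈ g := fun j => by
    obtain ⟨m, hm⟩ := hg'.exists_insert hκ hM hα hβ j
    exact ⟨m, hg.le_of_ge hm (Set.subset_insert _ _) (Set.mem_insert _ _)⟩
  choose b hb using htot
  refine ⟨b, fun φ hφ => ?_⟩
  obtain ⟨n, t, ψ, -, hψ⟩ := exists_formula_sum_fin (M := M) φ
  refine (hψ a b).2 (hg' n (fun k => (t k, b (t k))) (fun k => hb _) ψ ?_)
  filter_upwards [hU φ hφ] with x hx
  exact (hψ a x).1 hx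

/-! ### Type-definable conditions -/

/-- A condition on tuples is type-definable (over the empty set) if it is defined by a set of
formulas without parameters. -/
def IsTypeDefinableCondition {α : Type*} (L : FirstOrder.Language.{u, v}) [L.Structure M]
    (P : (α → M) → Prop) : Prop :=
  ∃ Γ : Set (L.Formula α), ∀ a, P a ↔ ∀ φ ∈ Γ, φ.Realize a

namespace IsTypeDefinableCondition

variable {α β : Type*} {P Q : (α → M) → Prop}

theorem all {J : Type*} {P : J → (α → M) → Prop}
    (h : ∀ j, IsTypeDefinableCondition L (P j)) :
    IsTypeDefinableCondition L fun a => ∀ j, P j a := by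
  choose Γ hΓ using h
  refine ⟨⋃ j, Γ j, fun a => ?_⟩
  simp only [hΓ, Set.mem_iUnion, forall_exists_index]
  exact forall_comm

theorem and (hP : IsTypeDefinableCondition L P) (hQ : IsTypeDefinableCondition L Q) :
    IsTypeDefinableCondition L fun a => P a ∧ Q a := by
  obtain ⟨Γ, hΓ⟩ := hP
  obtain ⟨Δ, hΔ⟩ := hQ
  exact ⟨Γ ∪ Δ, fun a => by simp only [hΓ, hΔ, Set.mem_union, or_imp, forall_and]⟩

theorem or (hP : IsTypeDefinableCondition L P) (hQ : IsTypeDefinableCondition L Q) :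
    IsTypeDefinableCondition L fun a => P a ∨ Q a := by
  obtain ⟨Γ, hΓ⟩ := hP
  obtain ⟨Δ, hΔ⟩ := hQ
  refine ⟨Set.image2 (· ⊔ ·) Γ Δ, fun a => ?_⟩
  simp only [Set.forall_mem_image2, Formula.realize_sup, hΓ, hΔ]
  constructor
  · rintro (h | h) φ hφ ψ hψ
    exacts [Or.inl (h φ hφ), Or.inr (h ψ hψ)]
  · intro h
    by_contra! ⟨⟨φ, hφ, h1⟩, ψ, hψ, h2⟩
    exact (h φ hφ ψ hψ).elim h1 h2

theorem comp (hP : IsTypeDefinableCondition L P) (r : α → β) :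
    IsTypeDefinableCondition L fun b : β → M => P (b ∘ r) := by
  obtain ⟨Γ, hΓ⟩ := hP
  refine ⟨Formula.relabel r '' Γ, fun b => ?_⟩
  simp only [hΓ, Set.forall_mem_image, Formula.realize_relabel]

theorem eq (i j : α) : IsTypeDefinableCondition L fun a : α → M => a i = a j :=
  ⟨{Term.equal (Term.var i) (Term.var j)}, fun a => by simp [Formula.realize_equal]⟩

theorem sameType {α : Type w} (m : α → M) : IsTypeDefinableCondition L fun a => SameType L m a := by
  refine ⟨{φ | φ.Realize m}, fun a => ⟨fun h φ hφ => (h φ).1 hφ, fun h φ => ⟨h φ, fun ha => ?_⟩⟩⟩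
  by_contra hm
  exact h (∼φ) hm ha

/-- In a saturated structure, type-definable conditions are closed under quantification over
a small tuple. -/
theorem exists_tuple (hκ : Cardinal.aleph0 ≤ κ) (hM : IsSaturated L M κ) {α β : Type w}
    (hα : Cardinal.mk α < κ) (hβ : Cardinal.mk β < κ) {P : (α ⊕ β → M) → Prop}
    (hP : IsTypeDefinableCondition L P) :
    IsTypeDefinableCondition L fun a : α → M => ∃ b : β → M, P (Sum.elim a b) := by
  obtain ⟨Γ, hΓ⟩ := hP
  refine ⟨{ψ | ∀ a, (∃ b : β → M, P (Sum.elim a b)) → ψ.Realize a},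
    fun a => ⟨fun h ψ hψ => hψ a h, fun h => ?_⟩⟩
  simp only [hΓ]
  refine hM.exists_tuple hκ hα hβ a Γ fun q hq => ?_
  obtain ⟨ψ, hψ⟩ := exists_formula_iff_exists (M := M) q
  refine (hψ a).1 (h ψ fun a' ⟨b, hb⟩ => (hψ a').2 ⟨b, fun φ hφ => ?_⟩)
  exact (hΓ _).1 hb φ (hq hφ)

end IsTypeDefinableCondition

theorem isTypeDefinable_iff_condition {α : Type w} {E : (α → M) → (α → M) → Prop} :
    IsTypeDefinable L E ↔
      IsTypeDefinableCondition L fun a : α ⊕ α → M => E (a ∘ Sum.inl) (a ∘ Sum.inr) := by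
  refine exists_congr fun Γ => ⟨fun h a => ?_, fun h x y => h (Sum.elim x y)⟩
  simp only [h, Sum.elim_comp_inl_inr]

/-! ### Stabilizers of hyperimaginaries -/

namespace Hyperimaginary

/-- A tuple whose class is the hyperimaginary `e`. -/
noncomputable def rep (e : Hyperimaginary L M κ) : e.ι → M := e.cls.out

theorem rel_comp_rep (e : Hyperimaginary L M κ) (f g : M ≃[L] M) :
    e.rel (f ∘ e.rep) (g ∘ e.rep) ↔ f⁻¹ * g ∈ e.fix := by
  have h : ∀ f : M ≃[L] M, f • e.cls = Quotient.mk e.rel (f ∘ e.rep) := fun f => by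
    conv_lhs => rw [← Quotient.out_eq e.cls]
    rfl
  rw [fix, MulAction.mem_stabilizer_iff, mul_smul, inv_smul_eq_iff, h, h, eq_comm]
  exact Quotient.eq.symm

end Hyperimaginary

theorem mem_dcl_singleton {c d : Hyperimaginary L M κ} : d ∈ dcl {c} ↔ c.fix ≤ d.fix := by
  simp [dcl, SetLike.le_def]

theorem dcl_congr {A B : Set (Hyperimaginary L M κ)}
    (h : ∀ f : M ≃[L] M, (∀ e ∈ A, f ∈ e.fix) ↔ ∀ e ∈ B, f ∈ e.fix) : dcl A = dcl B := by
  ext d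
  exact forall_congr' fun f => imp_congr_left (h f)

theorem isInf_of_fix_eq_sup {c e d : Hyperimaginary L M κ} (h : c.fix = e.fix ⊔ d.fix) :
    IsInf c e d := by
  ext x
  rw [Set.mem_inter_iff, mem_dcl_singleton, mem_dcl_singleton, mem_dcl_singleton, h, sup_le_iff]

/-! ### Hyperimaginaries with a prescribed stabilizer -/

namespace IsMonster

theorem aleph0_le (hM : IsMonster L M κ) : Cardinal.aleph0 ≤ κ := hM.uncountable.le

/-- The realizations of the type of a small tuple are its conjugates. -/
theorem sameType_iff (hM : IsMonster L M κ) {α : Type w} (hα : Cardinal.mk α < κ) {m z : α → M} :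
    SameType L m z ↔ ∃ f : M ≃[L] M, f ∘ m = z := by
  constructor
  · intro h
    obtain ⟨f, hf⟩ := hM.homogeneous α m z hα h
    exact ⟨f, funext hf⟩
  · rintro ⟨f, rfl⟩ φ
    exact (StrongHomClass.realize_formula f φ).symm

theorem mk_sum_lt (hM : IsMonster L M κ) {α β : Type w} (hα : Cardinal.mk α < κ)
    (hβ : Cardinal.mk β < κ) : Cardinal.mk (α ⊕ β) < κ := by
  rw [Cardinal.mk_sum, Cardinal.lift_id, Cardinal.lift_id]
  exact Cardinal.add_lt_of_lt hM.aleph0_le hα hβ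

/-- As `κ` may be singular, smallness of `Σ j, ι j` needs a uniform bound on the `ι j`. -/
theorem mk_sigma_lt (hM : IsMonster L M κ) {J : Type w} (hJ : Cardinal.mk J < κ) (ι : J → Type w)
    [∀ j, Finite (ι j)] : Cardinal.mk (Σ j, ι j) < κ := by
  rw [Cardinal.mk_sigma]
  refine (Cardinal.sum_le_sum _ (fun _ => Cardinal.aleph0) fun j => Cardinal.mk_le_aleph0).trans_lt ?_
  rw [Cardinal.sum_const']
  exact Cardinal.mul_lt_of_lt hM.aleph0_le hJ hM.uncountable

theorem mk_finset_lt (hM : IsMonster L M κ) {I : Type w} (hI : Cardinal.mk I < κ) :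
    Cardinal.mk (Finset I) < κ := by
  cases finite_or_infinite I
  · exact Cardinal.mk_lt_aleph0.trans_le hM.aleph0_le
  · rwa [Cardinal.mk_finset_of_infinite]

/-- A subgroup `H` of the automorphism group is the stabilizer of a hyperimaginary as soon as, on
the conjugates of some small tuple `m`, lying in the same coset of `H` is type-definable. The
equivalence relation is extended by equality to the tuples not conjugate to `m`. -/
theorem exists_fix_eq (hM : IsMonster L M κ) {α : Type w} (hα : Cardinal.mk α < κ) (m : α → M)
    (H : Subgroup (M ≃[L] M)) {R : (α → M) → (α → M) → Prop}
    (hR : IsTypeDefinableCondition L fun a : α ⊕ α → M => R (a ∘ Sum.inl) (a ∘ Sum.inr))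
    (h : ∀ f g : M ≃[L] M, R (f ∘ m) (g ∘ m) ↔ f⁻¹ * g ∈ H) :
    ∃ c : Hyperimaginary L M κ, c.ι = α ∧ c.fix = H := by
  let S : (α → M) → (α → M) → Prop := fun x y =>
    x = y ∨ (SameType L m x ∧ SameType L m y) ∧ R x y
  have hS : ∀ f g : M ≃[L] M, S (f ∘ m) (g ∘ m) ↔ f⁻¹ * g ∈ H := by
    intro f g
    constructor
    · rintro (h1 | h1)
      · rw [← h, ← h1, h, inv_mul_cancel]
        exact H.one_mem
      · exact (h f g).1 h1.2
    · exact fun h1 => Or.inr ⟨⟨(hM.sameType_iff hα).2 ⟨f, rfl⟩,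
        (hM.sameType_iff hα).2 ⟨g, rfl⟩⟩, (h f g).2 h1⟩
  have hS' : ∀ x y, S x y → x = y ∨ ∃ f g : M ≃[L] M, f ∘ m = x ∧ g ∘ m = y ∧ f⁻¹ * g ∈ H := by
    rintro x y (h1 | ⟨⟨h1, h2⟩, h3⟩)
    · exact Or.inl h1
    · obtain ⟨f, rfl⟩ := (hM.sameType_iff hα).1 h1
      obtain ⟨g, rfl⟩ := (hM.sameType_iff hα).1 h2
      exact Or.inr ⟨f, g, rfl, rfl, (h f g).1 h3⟩
  let s : Setoid (α → M) :=
    { r := S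
      iseqv :=
        { refl := fun x => Or.inl rfl
          symm := by
            intro x y hxy
            obtain rfl | ⟨f, g, rfl, rfl, hH⟩ := hS' x y hxy
            · exact Or.inl rfl
            · rw [hS]
              simpa using H.inv_mem hH
          trans := by
            intro x y z hxy hyz
            obtain rfl | ⟨f, g, rfl, hg, hH⟩ := hS' x y hxy
            · exact hyz
            · obtain rfl | ⟨f', g', hf', rfl, hH'⟩ := hS' y z hyz
              · exact hxy
              · subst hf'
                rw [hS]
                have h1 : g⁻¹ * f' ∈ H := (hS g f').1 (Or.inl hg)
                have h2 := H.mul_mem (H.mul_mem hH h1) hH'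
                rwa [show f⁻¹ * g * (g⁻¹ * f') * (f'⁻¹ * g') = f⁻¹ * g' by group] at h2 } }
  have hs : IsTypeDefinable L fun x y => s x y := by
    rw [isTypeDefinable_iff_condition]
    have h1 : IsTypeDefinableCondition L fun a : α ⊕ α → M => a ∘ Sum.inl = a ∘ Sum.inr := by
      simp only [funext_iff]
      exact .all fun i => .eq (Sum.inl i) (Sum.inr i)
    exact h1.or ((((IsTypeDefinableCondition.sameType m).comp Sum.inl).and
      ((IsTypeDefinableCondition.sameType m).comp Sum.inr)).and hR)
  refine ⟨⟨α, hα, s, hs, Quotient.mk s m⟩, rfl, ?_⟩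
  ext f
  have h1 : S (f ∘ m) m ↔ f ∈ H := (hS f 1).trans (by simp)
  exact Iff.trans Quotient.eq h1

/-- The supremum of the stabilizers of `e` and `d` is again the stabilizer of a hyperimaginary if
`e` is normal: for representatives `a` of `e` and `b` of `d`, conjugates `f (a, b)` and `g (a, b)`
are in the same coset iff some conjugate `(x, y)` of `(a, b)` has the `e`-class of `f a` and the
`d`-class of `g b`. -/
theorem exists_fix_eq_sup (hM : IsMonster L M κ) {e : Hyperimaginary L M κ} (he : e.IsNormal)
    (d : Hyperimaginary L M κ) : ∃ c : Hyperimaginary L M κ, c.fix = e.fix ⊔ d.fix := by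
  have hα := hM.mk_sum_lt e.small d.small
  let m : e.ι ⊕ d.ι → M := Sum.elim e.rep d.rep
  have hR := IsTypeDefinableCondition.exists_tuple hM.aleph0_le hM.saturated
    (hM.mk_sum_lt hα hα) hα
    (((IsTypeDefinableCondition.sameType (L := L) m).comp Sum.inr).and
      (((isTypeDefinable_iff_condition.1 e.typeDefinable).comp
        (Sum.elim (Sum.inr ∘ Sum.inl) (Sum.inl ∘ Sum.inl ∘ Sum.inl))).and
      ((isTypeDefinable_iff_condition.1 d.typeDefinable).comp
        (Sum.elim (Sum.inr ∘ Sum.inr) (Sum.inl ∘ Sum.inr ∘ Sum.inr)))))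
  obtain ⟨c, -, hc⟩ := hM.exists_fix_eq hα m (e.fix ⊔ d.fix)
    (R := fun z z' => ∃ w : e.ι ⊕ d.ι → M, SameType L m w ∧
      e.rel (w ∘ Sum.inl) (z ∘ Sum.inl) ∧ d.rel (w ∘ Sum.inr) (z' ∘ Sum.inr)) hR (by
    intro f g
    have : e.fix.Normal := he
    rw [Subgroup.mem_sup_of_normal_left]
    constructor
    · rintro ⟨w, hw, hwe, hwd⟩
      obtain ⟨k, rfl⟩ := (hM.sameType_iff hα).1 hw
      refine ⟨(k⁻¹ * f)⁻¹, e.fix.inv_mem ((e.rel_comp_rep k f).1 hwe), k⁻¹ * g,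
        (d.rel_comp_rep k g).1 hwd, by group⟩
    · rintro ⟨y, hy, z, hz, hyz⟩
      refine ⟨(f * y : M ≃[L] M) ∘ m, (hM.sameType_iff hα).2 ⟨_, rfl⟩,
        (e.rel_comp_rep (f * y) f).2 ?_, (d.rel_comp_rep (f * y) g).2 ?_⟩
      · simpa using hy
      · simpa [mul_assoc, ← hyz] using hz)
  exact ⟨c, hc⟩

/-- A hyperimaginary definable over a small tuple `m` has a representative which is a class of
tuples of the length of `m`. -/
theorem exists_fix_eq_of_tuple (hM : IsMonster L M κ) (e : Hyperimaginary L M κ) {α : Type w}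
    (hα : Cardinal.mk α < κ) (m : α → M) (hm : ∀ f : M ≃[L] M, f ∘ m = m → f ∈ e.fix) :
    ∃ c : Hyperimaginary L M κ, c.ι = α ∧ c.fix = e.fix := by
  have hαe := hM.mk_sum_lt hα e.small
  let p : α ⊕ e.ι → M := Sum.elim m e.rep
  have hR := IsTypeDefinableCondition.exists_tuple hM.aleph0_le hM.saturated
    (hM.mk_sum_lt hα hα) (hM.mk_sum_lt e.small e.small)
    (((IsTypeDefinableCondition.sameType (L := L) p).comp
      (Sum.elim (Sum.inl ∘ Sum.inl) (Sum.inr ∘ Sum.inl))).and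
    (((IsTypeDefinableCondition.sameType (L := L) p).comp
      (Sum.elim (Sum.inl ∘ Sum.inr) (Sum.inr ∘ Sum.inr))).and
    ((isTypeDefinable_iff_condition.1 e.typeDefinable).comp Sum.inr)))
  simp only [Sum.comp_elim] at hR
  -- a conjugate of `m` determines the `e`-class of the corresponding conjugate of `e.rep`
  have key : ∀ (f : M ≃[L] M) (x : e.ι → M), SameType L p (Sum.elim (f ∘ m) x) →
      e.rel (f ∘ e.rep) x := by
    intro f x hx
    obtain ⟨k, hk⟩ := (hM.sameType_iff hαe).1 hx
    obtain rfl : k ∘ e.rep = x := congrArg (· ∘ Sum.inr) hk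
    rw [e.rel_comp_rep]
    refine hm _ (funext fun i => ?_)
    have hi : k (m i) = f (m i) := congrFun hk (Sum.inl i)
    exact (congrArg f.symm hi).trans (f.symm_apply_apply _)
  refine hM.exists_fix_eq hα m e.fix
    (R := fun z z' => ∃ w : e.ι ⊕ e.ι → M, SameType L p (Sum.elim z (w ∘ Sum.inl)) ∧
      SameType L p (Sum.elim z' (w ∘ Sum.inr)) ∧ e.rel (w ∘ Sum.inl) (w ∘ Sum.inr)) hR ?_
  intro f g
  rw [← e.rel_comp_rep]
  constructor
  · rintro ⟨w, h1, h2, h3⟩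
    exact e.rel.trans (key f _ h1) (e.rel.trans h3 (e.rel.symm (key g _ h2)))
  · intro h
    refine ⟨Sum.elim (f ∘ e.rep) (g ∘ e.rep), ?_, ?_, h⟩
    · exact (hM.sameType_iff hαe).2 ⟨f, Sum.comp_elim ..⟩
    · exact (hM.sameType_iff hαe).2 ⟨g, Sum.comp_elim ..⟩

/-- A finitary hyperimaginary has a representative which is a class of finite tuples. -/
theorem exists_finite_fix_eq (hM : IsMonster L M κ) {e : Hyperimaginary L M κ}
    (he : e.IsFinitary) : ∃ c : Hyperimaginary L M κ, Finite c.ι ∧ c.fix = e.fix := by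
  obtain ⟨A, hA, h⟩ := he
  have : Finite A := hA
  obtain ⟨c, hc, hfix⟩ := hM.exists_fix_eq_of_tuple e
    (Cardinal.mk_lt_aleph0.trans_le hM.aleph0_le) (fun x : A => (x : M))
    fun f hf => h f fun x hx => congrFun hf ⟨x, hx⟩
  exact ⟨c, hc ▸ this, hfix⟩

/-- The concatenation of a family of hyperimaginaries of small total length. -/
theorem exists_fix_eq_iInf (hM : IsMonster L M κ) {J : Type w} (e : J → Hyperimaginary L M κ)
    (hJ : Cardinal.mk (Σ j, (e j).ι) < κ) :
    ∃ c : Hyperimaginary L M κ, c.fix = ⨅ j, (e j).fix := by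
  obtain ⟨c, -, hc⟩ := hM.exists_fix_eq hJ (fun x => (e x.1).rep x.2) (⨅ j, (e j).fix)
    (R := fun z z' => ∀ j, (e j).rel (fun i => z ⟨j, i⟩) (fun i => z' ⟨j, i⟩))
    (.all fun j => (isTypeDefinable_iff_condition.1 (e j).typeDefinable).comp
      (Sum.map (fun i => (⟨j, i⟩ : Σ j, (e j).ι)) fun i => (⟨j, i⟩ : Σ j, (e j).ι)))
    (fun f g => by
      rw [Subgroup.mem_iInf]
      exact forall_congr' fun j => (e j).rel_comp_rep f g)
  exact ⟨c, hc⟩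

/-- Compactness for cosets of stabilizers: if any finitely many of the cosets `f j * Fix(e j)` have
a common element, and the total length of the `e j` is small, then all of them have one. -/
theorem exists_mem_cosets (hM : IsMonster L M κ) {J : Type w} (e : J → Hyperimaginary L M κ)
    (hJ : Cardinal.mk (Σ j, (e j).ι) < κ) (f : J → M ≃[L] M)
    (h : ∀ s : Finset J, ∃ g : M ≃[L] M, ∀ j ∈ s, (f j)⁻¹ * g ∈ (e j).fix) :
    ∃ g : M ≃[L] M, ∀ j, (f j)⁻¹ * g ∈ (e j).fix := by
  classical
  choose Γ hΓ using fun j => (e j).typeDefinable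
  let m : (Σ j, (e j).ι) → M := fun x => (e x.1).rep x.2
  let a : (Σ j, (e j).ι) → M := fun x => f x.1 (m x)
  have ha : ∀ (j : J) (b : (Σ j, (e j).ι) → M),
      Sum.elim a b ∘ Sum.map (Sigma.mk j) (Sigma.mk j) =
        Sum.elim (f j ∘ (e j).rep) (b ∘ Sigma.mk j) := fun j b => Sum.elim_comp_map
  let p : Set (L.Formula ((Σ j, (e j).ι) ⊕ (Σ j, (e j).ι))) :=
    Formula.relabel Sum.inr '' {φ | φ.Realize m} ∪
      ⋃ j, Formula.relabel (Sum.map (Sigma.mk j) (Sigma.mk j)) '' Γ j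
  -- each formula of `p` constrains only finitely many of the cosets
  have hp : ∀ φ ∈ p, ∃ s : Finset J, ∀ g : M ≃[L] M, (∀ j ∈ s, (f j)⁻¹ * g ∈ (e j).fix) →
      φ.Realize (Sum.elim a (g ∘ m)) := by
    rintro _ (⟨φ, hφ, rfl⟩ | hφ')
    · refine ⟨∅, fun g _ => ?_⟩
      rw [Formula.realize_relabel, Sum.elim_comp_inr]
      exact (StrongHomClass.realize_formula g φ).2 hφ
    · obtain ⟨j, φ, hφ, rfl⟩ := Set.mem_iUnion.1 hφ'
      refine ⟨{j}, fun g hg => ?_⟩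
      rw [Formula.realize_relabel, ha]
      exact (hΓ j _ _).1 (((e j).rel_comp_rep (f j) g).2 (hg j (Finset.mem_singleton_self j))) φ hφ
  choose! S hS using hp
  obtain ⟨b, hb⟩ := hM.saturated.exists_tuple hM.aleph0_le hJ hJ a p fun q hq => by
    obtain ⟨g, hg⟩ := h (q.biUnion S)
    exact ⟨g ∘ m, fun φ hφ => hS φ (hq hφ) g fun j hj => hg j (Finset.mem_biUnion.2 ⟨φ, hφ, hj⟩)⟩
  have hmb : SameType L m b := by
    have h1 : ∀ φ : L.Formula _, φ.Realize m → φ.Realize b := fun φ hφ => by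
      simpa [Formula.realize_relabel] using hb _ (Or.inl ⟨φ, hφ, rfl⟩)
    refine fun φ => ⟨h1 φ, fun hφ => ?_⟩
    by_contra hn
    exact h1 (∼φ) hn hφ
  obtain ⟨g, rfl⟩ := (hM.sameType_iff hJ).1 hmb
  refine ⟨g, fun j => ((e j).rel_comp_rep (f j) g).1 ((hΓ j _ _).2 fun φ hφ => ?_)⟩
  have := hb _ (Or.inr (Set.mem_iUnion.2 ⟨j, φ, hφ, rfl⟩))
  rwa [Formula.realize_relabel, ha] at this

/-! ### Peter-Weyl families -/

/-- The compactness step. If `f` lies in `Fix(e i) ⊔ Fix(d)` for all `i`, then for each `i` some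
element of `Fix(e i)` agrees with `f` on `d`; as the family is directed, a single `g` in all the
`Fix(e i)` does, and this `g` fixes the bounded `d`. The `e i` are first represented by classes of
finite tuples: `κ` may be singular, so their total length need not be small otherwise. -/
theorem mem_fix_of_forall_mem_sup (hM : IsMonster L M κ) {I : Type w}
    {e : I → Hyperimaginary L M κ} (he : IsPeterWeylFamily e) (hc : ClosedUnderComposition e)
    {d : Hyperimaginary L M κ} (hd : d ∈ bdd L M κ) {f : M ≃[L] M}
    (hf : ∀ i, f ∈ (e i).fix ⊔ d.fix) : f ∈ d.fix := by
  have hdir : Directed (· ≥ ·) fun i => (e i).fix := by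
    intro i j
    obtain ⟨k, hk⟩ := hc i j
    have h : ∀ x ∈ ({e i, e j} : Set _), (e k).fix ≤ x.fix := fun x hx => by
      rw [← mem_dcl_singleton, hk]
      exact fun g hg => hg x hx
    exact ⟨k, h _ (by simp), h _ (by simp)⟩
  choose c hcfin hcfix using fun i => hM.exists_finite_fix_eq (he.finitary i)
  have hsmall : Cardinal.mk (Σ j : I ⊕ PUnit.{w + 1}, (Sum.elim c (fun _ => d) j).ι) < κ := by
    rw [Cardinal.mk_congr (Equiv.sumSigmaDistrib _)]
    refine hM.mk_sum_lt (hM.mk_sigma_lt he.small fun i => (c i).ι) ?_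
    rw [Cardinal.mk_congr (Equiv.uniqueSigma _)]
    exact d.small
  -- an element of `Fix(e i)` for all `i` which agrees with `f` on `d`
  obtain ⟨g, hg⟩ := hM.exists_mem_cosets (Sum.elim c fun _ => d) hsmall
    (Sum.elim (fun _ => 1) fun _ => f) (by
    intro s
    cases isEmpty_or_nonempty I
    · refine ⟨f, ?_⟩
      rintro (i | _) -
      · exact isEmptyElim i
      · simp
    · obtain ⟨k, hk⟩ := hdir.finset_le s.toLeft
      have : (e k).fix.Normal := he.normal k
      obtain ⟨y, hy, z, hz, rfl⟩ := Subgroup.mem_sup_of_normal_left.1 (hf k)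
      refine ⟨y, ?_⟩
      rintro (i | _) hi
      · simpa [hcfix] using hk i (Finset.mem_toLeft.2 hi) hy
      · simpa using hz)
  have hgd : g ∈ d.fix := by
    rw [← he.dcl_eq_bdd] at hd
    refine hd g ?_
    rintro _ ⟨i, rfl⟩
    simpa [hcfix] using hg (Sum.inl i)
  have hfg : f⁻¹ * g ∈ d.fix := hg (Sum.inr ⟨⟩)
  simpa using (Subgroup.mul_mem_cancel_right _ hgd).1 hfg

theorem exists_isInf (hM : IsMonster L M κ) {e : Hyperimaginary L M κ} (hfin : e.IsFinitary)
    (hnorm : e.IsNormal) (d : Hyperimaginary L M κ) :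
    ∃ c : Hyperimaginary L M κ, c.IsFinitary ∧ IsInf c e d ∧ c.fix = e.fix ⊔ d.fix := by
  obtain ⟨c, hc⟩ := hM.exists_fix_eq_sup hnorm d
  obtain ⟨A, hA, h⟩ := hfin
  refine ⟨c, ⟨A, hA, fun f hf => ?_⟩, isInf_of_fix_eq_sup hc, hc⟩
  rw [hc]
  exact Subgroup.mem_sup_left (h f hf)

/-- Over a Peter-Weyl family closed under composition, a bounded hyperimaginary is interdefinable
with the sequence of its infima with the members of the family. -/
theorem exists_isInf_interdefinable (hM : IsMonster L M κ) {I : Type w}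
    {e : I → Hyperimaginary L M κ} (he : IsPeterWeylFamily e) (hc : ClosedUnderComposition e)
    {d : Hyperimaginary L M κ} (hd : d ∈ bdd L M κ) :
    ∃ c : I → Hyperimaginary L M κ, (∀ i, (c i).IsFinitary ∧ IsInf (c i) (e i) d) ∧
      InterdefinableWithSeq d c := by
  choose c hfin hinf hfix using fun i => hM.exists_isInf (he.finitary i) (he.normal i) d
  refine ⟨c, fun i => ⟨hfin i, hinf i⟩, dcl_congr fun f => ?_⟩
  simp only [Set.mem_singleton_iff, forall_eq, Set.forall_mem_range, hfix]
  exact ⟨fun h i => Subgroup.mem_sup_right h, hM.mem_fix_of_forall_mem_sup he hc hd⟩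

/-- The finite compositions of a Peter-Weyl family. -/
theorem exists_finite_compositions (hM : IsMonster L M κ) {I : Type w}
    {e : I → Hyperimaginary L M κ} (he : IsPeterWeylFamily e) :
    ∃ e' : Finset I → Hyperimaginary L M κ, (∀ s : Finset I, dcl {e' s} = dcl (e '' s)) ∧
      IsPeterWeylFamily e' ∧ ClosedUnderComposition e' := by
  classical
  choose c hcfin hcfix using fun i => hM.exists_finite_fix_eq (he.finitary i)
  choose e' he' using fun s : Finset I => hM.exists_fix_eq_iInf (fun i : s => c i)
    (hM.mk_sigma_lt (Cardinal.mk_lt_aleph0.trans_le hM.aleph0_le) fun i : s => (c i).ι)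
  have hmem : ∀ (s : Finset I) (f : M ≃[L] M), f ∈ (e' s).fix ↔ ∀ i ∈ s, f ∈ (e i).fix := by
    intro s f
    simp [he', Subgroup.mem_iInf, hcfix]
  refine ⟨e', fun s => dcl_congr fun f => by simp [hmem], ⟨hM.mk_finset_lt he.small, fun s => ?_,
    fun s => ⟨fun f hf g => ?_⟩, ?_⟩, fun s t => ⟨s ∪ t, dcl_congr fun f => ?_⟩⟩
  · choose A hA h using he.finitary
    refine ⟨⋃ i ∈ s, A i, s.finite_toSet.biUnion fun i _ => hA i, fun f hf => ?_⟩
    exact (hmem s f).2 fun i hi => h i f fun x hx => hf x (Set.mem_biUnion hi hx)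
  · exact (hmem s _).2 fun i hi => (he.normal i).conj_mem f ((hmem s f).1 hf i hi) g
  · rw [← he.dcl_eq_bdd]
    refine dcl_congr fun f => ?_
    simp only [Set.forall_mem_range, hmem]
    exact ⟨fun h i => h {i} i (Finset.mem_singleton_self i), fun h s i _ => h i⟩
  · simp [hmem, or_imp, forall_and]

end IsMonster
end NormalHyperimaginaries

theorem mainTheorem1 {L : FirstOrder.Language.{u, v}} {M : Type w} [L.Structure M]
    {κ : Cardinal.{w}} (hM : IsMonster L M κ)
    (hPW : PeterWeylCondition L M κ) :
    -- every bounded hyperimaginary is interdefinable with a sequence of finitary ones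
    (∀ d ∈ bdd L M κ,
      ∃ (J : Type w) (c : J → Hyperimaginary L M κ),
        Cardinal.mk J < κ ∧ (∀ j, (c j).IsFinitary) ∧
        InterdefinableWithSeq d c) ∧
    -- the finite compositions of a Peter-Weyl family form a closed Peter-Weyl family
    (∀ (I : Type w) (e : I → Hyperimaginary L M κ),
      IsPeterWeylFamily e →
      ∃ e' : Finset I → Hyperimaginary L M κ,
        (∀ s : Finset I, dcl {e' s} = dcl (e '' s)) ∧
        IsPeterWeylFamily e' ∧
        ClosedUnderComposition e') ∧
    -- for a closed family, the sequence can be taken to be `(inf(e i, d) : i ∈ I)`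
    (∀ (I : Type w) (e : I → Hyperimaginary L M κ),
      IsPeterWeylFamily e →
      ClosedUnderComposition e →
      ∀ d ∈ bdd L M κ,
        ∃ c : I → Hyperimaginary L M κ,
          (∀ i, (c i).IsFinitary ∧ IsInf (c i) (e i) d) ∧
          InterdefinableWithSeq d c) := by
  refine ⟨fun d hd => ?_, fun I e he => hM.exists_finite_compositions he,
    fun I e he hc d hd => hM.exists_isInf_interdefinable he hc hd⟩
  obtain ⟨I, e, he⟩ := hPW
  obtain ⟨e', -, he', hc⟩ := hM.exists_finite_compositions he
  obtain ⟨c, hcinf, hdc⟩ := hM.exists_isInf_interdefinable he' hc hd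
  exact ⟨Finset I, c, he'.small, fun s => (hcinf s).1, hdc⟩
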